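/- Let $(X_1,X_2,\ldots)$ be an infinite exchangeable sequence of real-valued random variables on a probability space, that is, a sequence whose joint distribution is invariant under finite permutations of the indices. For $n\ge 1$ let $K_n=\#\{X_i : 1\le i\le n\}$ be the number of distinct values among its first $n$ terms. Then for every $n\ge 3$, $$\mathbb{P}(K_n=2)\le 1-2^{-(n-1)}.$$ -/

import Mathlib

open MeasureTheory ProbabilityTheory

/-- An infinite sequence of real random variables is exchangeable under `μ` if its joint law (a
measure on the space of real sequences) is invariant under finite permutations of the indices. -/
def Exchangeable {Ω : Type*} [MeasurableSpace Ω] (X : ℕ → Ω → ℝ) (μ : Measure Ω) : Prop :=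
  ∀ σ : Equiv.Perm ℕ, {i | σ i ≠ i}.Finite →
    IdentDistrib (fun ω i => X (σ i) ω) (fun ω i => X i ω) μ μ

/-- The number `K_n` of distinct values among the first `n` terms of the sequence
(the terms are indexed from `0`, so these are `X 0, …, X (n - 1)`). -/
noncomputable def numDistinct {Ω : Type*} (X : ℕ → Ω → ℝ) (n : ℕ) (ω : Ω) : ℕ :=
  ((Finset.range n).image (fun i => X i ω)).card

/-! No de Finetti representation is needed. By exchangeability, `X` read along any injection `Fin n
→ Fin N` shows two values with the same probability, so `descFactorial` times this probability is
the expected number of such injections. Pointwise, admitting all maps only enlarges the count, which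
becomes sampling with replacement from a finite population; `N → ∞` removes the correction. For
weights with replacement, merging the two lightest letters does not decrease the two-letter mass
(`twoLetterMass_cons_cons_le`): lost words on that pair are paid for by words on it and one heavier
letter, which needs length at least 3. With two letters left, convexity gives the constant. -/

/-! ### Inequalities for letter weights -/

/-- The mass, under i.i.d. sampling, of the words of length `n` using exactly two given letters
of weights `x` and `y`. -/
def pairMass (n : ℕ) (x y : ℝ) : ℝ := (x + y) ^ n - x ^ n - y ^ n

lemma pairMass_succ (n : ℕ) (x y : ℝ) :
    pairMass (n + 1) x y = (x + y) * pairMass n x y + x * y ^ n + y * x ^ n := by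
  simp only [pairMass]; ring

lemma pairMass_nonneg {n : ℕ} (hn : n ≠ 0) {x y : ℝ} (hx : 0 ≤ x) (hy : 0 ≤ y) :
    0 ≤ pairMass n x y := by
  have := pow_add_pow_le hx hy hn
  simp only [pairMass]; linarith

lemma le_pairMass {n : ℕ} (hn : n ≠ 0) {x y : ℝ} (hx : 0 ≤ x) (hy : 0 ≤ y) :
    x * y ^ n + y * x ^ n ≤ pairMass (n + 1) x y := by
  have := mul_nonneg (add_nonneg hx hy) (pairMass_nonneg hn hx hy)
  rw [pairMass_succ]; linarith

/-- The mass of the words of length `n` using exactly the three atoms of weights `x, y, z`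
dominates that of the words using exactly the two lightest ones. -/
lemma pairMass_le_tripleMass {x y z : ℝ} (hx : 0 ≤ x) (hxy : x ≤ y) (hyz : y ≤ z) (n : ℕ) :
    pairMass (n + 3) x y ≤
      pairMass (n + 3) (x + y) z - pairMass (n + 3) x z - pairMass (n + 3) y z := by
  have hy : 0 ≤ y := hx.trans hxy
  have hz : 0 ≤ z := hy.trans hyz
  induction n with
  | zero =>
    have h1 : 0 ≤ x * y * ((z - x) + (z - y)) := by
      apply mul_nonneg (mul_nonneg hx hy); linarith
    have h2 : pairMass (0 + 3) (x + y) z - pairMass (0 + 3) x z - pairMass (0 + 3) y z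
        - pairMass (0 + 3) x y = 3 * (x * y * ((z - x) + (z - y))) := by
      simp only [pairMass]; ring
    linarith
  | succ n ih =>
    have h1 : 0 ≤ (x + y) * (pairMass (n + 3) (x + y) z - pairMass (n + 3) x z
        - pairMass (n + 3) y z - pairMass (n + 3) x y) :=
      mul_nonneg (add_nonneg hx hy) (by linarith)
    have h2 : 0 ≤ z * (pairMass (n + 3) (x + y) z - pairMass (n + 3) x z
        - pairMass (n + 3) y z) :=
      mul_nonneg hz ((pairMass_nonneg (by lia) hx hy).trans ih)
    have h3 : 0 ≤ x * pairMass (n + 3) y z := mul_nonneg hx (pairMass_nonneg (by lia) hy hz)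
    have h4 : 0 ≤ y * pairMass (n + 3) x z := mul_nonneg hy (pairMass_nonneg (by lia) hx hz)
    have h5 : y * (x * y ^ (n + 2) + y * x ^ (n + 2)) ≤ z * pairMass (n + 3) x y :=
      mul_le_mul hyz (le_pairMass (by lia) hx hy) (by positivity) hz
    have h6 : 0 ≤ y * x ^ (n + 2) * (y - x) := mul_nonneg (by positivity) (by linarith)
    -- Split by the last letter: either all three letters have already occurred, or it is the
    -- missing one.
    have key : pairMass (n + 3 + 1) (x + y) z - pairMass (n + 3 + 1) x z
        - pairMass (n + 3 + 1) y z =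
        (x + y + z) * (pairMass (n + 3) (x + y) z - pairMass (n + 3) x z
          - pairMass (n + 3) y z) + x * pairMass (n + 3) y z + y * pairMass (n + 3) x z
          + z * pairMass (n + 3) x y := by
      simp only [pairMass]; ring
    rw [show n + 1 + 3 = n + 3 + 1 by lia, key, pairMass_succ]
    have e1 : x * y ^ (n + 3) = y * (x * y ^ (n + 2)) := by ring
    have e2 : y * x ^ (n + 3) = x * (y * x ^ (n + 2)) := by ring
    nlinarith

lemma pairMass_le (n : ℕ) {x y : ℝ} (hx : 0 ≤ x) (hy : 0 ≤ y) :
    pairMass n x y ≤ (1 - (1 / 2) ^ (n - 1)) * (x + y) ^ n := by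
  have h := add_pow_le hx hy n
  have h2 : ((1 / 2 : ℝ)) ^ (n - 1) * (x + y) ^ n ≤ x ^ n + y ^ n := by
    calc ((1 / 2 : ℝ)) ^ (n - 1) * (x + y) ^ n
        ≤ (1 / 2 : ℝ) ^ (n - 1) * (2 ^ (n - 1) * (x ^ n + y ^ n)) := by gcongr
      _ = x ^ n + y ^ n := by
        rw [← mul_assoc, ← mul_pow]; norm_num
  simp only [pairMass]; linarith

/-- The mass of the words of length `n` with exactly two distinct letters, when the letters have
the weights listed in `s`. -/
def twoLetterMass (n : ℕ) (s : Multiset ℝ) : ℝ :=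
  ((s.powersetCard 2).map fun t => t.sum ^ n - (t.map (· ^ n)).sum).sum

lemma twoLetterMass_zero (n : ℕ) : twoLetterMass n 0 = 0 := by
  rw [twoLetterMass, Multiset.powersetCard_zero_right]; rfl

lemma twoLetterMass_cons (n : ℕ) (x : ℝ) (s : Multiset ℝ) :
    twoLetterMass n (x ::ₘ s) = twoLetterMass n s + (s.map (pairMass n x)).sum := by
  simp only [twoLetterMass, Multiset.powersetCard_cons, Multiset.powersetCard_one,
    Multiset.map_add, Multiset.sum_add, Multiset.map_map, Function.comp_def]
  congr 3
  ext y
  simp [pairMass]; ring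

/-- Merging the two lightest of at least three letters does not decrease the mass of the
words with exactly two distinct letters. -/
lemma twoLetterMass_cons_cons_le {n : ℕ} (hn : 3 ≤ n) {x y : ℝ} {s : Multiset ℝ} (hs : s ≠ 0)
    (hx : 0 ≤ x) (hxy : x ≤ y) (hys : ∀ z ∈ s, y ≤ z) :
    twoLetterMass n (x ::ₘ y ::ₘ s) ≤ twoLetterMass n ((x + y) ::ₘ s) := by
  obtain ⟨m, rfl⟩ := Nat.exists_eq_add_of_le' hn
  obtain ⟨z, t, rfl⟩ : ∃ z t, s = z ::ₘ t := by
    obtain ⟨z, hz⟩ := Multiset.exists_mem_of_ne_zero hs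
    exact ⟨z, _, (Multiset.cons_erase hz).symm⟩
  -- One heavier letter `z` pays for the lost pair; for the others, a nonnegative triple mass
  -- suffices.
  have hz := pairMass_le_tripleMass hx hxy (hys z (Multiset.mem_cons_self z t)) m
  have ht : (t.map fun z => pairMass (m + 3) x z + pairMass (m + 3) y z).sum ≤
      (t.map (pairMass (m + 3) (x + y))).sum := by
    refine Multiset.sum_map_le_sum_map _ _ fun w hw => ?_
    have := pairMass_le_tripleMass hx hxy (hys w (Multiset.mem_cons_of_mem hw)) m
    have := pairMass_nonneg (n := m + 3) (by lia) hx (hx.trans hxy)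
    linarith
  rw [Multiset.sum_map_add] at ht
  simp only [twoLetterMass_cons, Multiset.map_cons, Multiset.sum_cons]
  linarith

lemma Multiset.exists_cons_forall_le {s : Multiset ℝ} (hs : s ≠ 0) :
    ∃ x t, s = x ::ₘ t ∧ ∀ y ∈ t, x ≤ y := by
  have hne : s.toFinset.Nonempty := by simpa using hs
  obtain ⟨x, hx, hmin⟩ := s.toFinset.exists_min_image id hne
  refine ⟨x, s.erase x, (Multiset.cons_erase (by simpa using hx)).symm, fun y hy => ?_⟩
  exact hmin y (by simpa using Multiset.mem_of_mem_erase hy)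

/-- Merging preserves the total weight and removes one letter, so induction on the number of letters
ends at a single pair. -/
lemma twoLetterMass_le {n : ℕ} (hn : 3 ≤ n) (s : Multiset ℝ) (hs : ∀ x ∈ s, 0 ≤ x) :
    twoLetterMass n s ≤ (1 - (1 / 2) ^ (n - 1)) * s.sum ^ n := by
  have hC : (0 : ℝ) ≤ 1 - (1 / 2) ^ (n - 1) := by
    have := pow_le_one₀ (n := n - 1) (a := (1 / 2 : ℝ)) (by norm_num) (by norm_num)
    linarith
  induction hk : s.card generalizing s with
  | zero =>
    obtain rfl := Multiset.card_eq_zero.mp hk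
    simp [twoLetterMass_zero, show n ≠ 0 by lia]
  | succ k ih =>
    obtain ⟨x, t, rfl, hxt⟩ := Multiset.exists_cons_forall_le
      (s := s) (by rintro rfl; simp at hk)
    have hx : 0 ≤ x := hs x (by simp)
    by_cases ht : t = 0
    · subst ht
      have : twoLetterMass n (x ::ₘ 0) = 0 := by
        rw [twoLetterMass_cons]; simp [twoLetterMass_zero]
      rw [this]
      simpa using mul_nonneg hC (pow_nonneg hx n)
    obtain ⟨y, u, rfl, hyu⟩ := Multiset.exists_cons_forall_le ht
    have hy : 0 ≤ y := hs y (by simp)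
    by_cases hu : u = 0
    · subst hu
      have h0 : twoLetterMass n (x ::ₘ y ::ₘ 0) = pairMass n x y := by
        rw [twoLetterMass_cons, twoLetterMass_cons]; simp [twoLetterMass_zero]
      rw [h0]
      simpa using pairMass_le n hx hy
    refine (twoLetterMass_cons_cons_le hn hu hx (hxt y (by simp)) hyu).trans ?_
    refine (ih ((x + y) ::ₘ u) ?_ ?_).trans_eq ?_
    · intro z hz
      rcases Multiset.mem_cons.mp hz with rfl | hz
      · positivity
      · exact hs z (by simp [hz])
    · simpa using hk
    · simp [add_assoc]

/-! ### Counting words in a finite sample -/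

/-- The words of length `n` over `ι` whose letters take exactly the two values in `t` under `x`. -/
lemma card_words_image_eq_le {ι : Type*} [Fintype ι] [DecidableEq ι] (x : ι → ℝ) {n : ℕ}
    (hn : n ≠ 0) {t : Finset ℝ} (ht : t.card = 2) :
    (({f : Fin n → ι | Finset.univ.image (fun i => x (f i)) = t} : Finset _).card : ℝ) ≤
      (∑ v ∈ t, (({i | x i = v} : Finset ι).card : ℝ)) ^ n
        - ∑ v ∈ t, (({i | x i = v} : Finset ι).card : ℝ) ^ n := by
  obtain ⟨a, b, hab, rfl⟩ := Finset.card_eq_two.mp ht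
  have i₀ : Fin n := ⟨0, Nat.pos_of_ne_zero hn⟩
  rw [Finset.sum_pair hab, Finset.sum_pair hab]
  set A : Finset ι := {i | x i = a} with hA
  set B : Finset ι := {i | x i = b} with hB
  set W : Finset (Fin n → ι) := {f | Finset.univ.image (fun i => x (f i)) = {a, b}} with hW
  have hAB : Disjoint A B := by
    rw [Finset.disjoint_left]
    intro i hi hi'
    simp only [hA, hB, Finset.mem_filter, Finset.mem_univ, true_and] at hi hi'
    exact hab (hi.symm.trans hi')
  have hWmem {f : Fin n → ι} (hf : f ∈ W) :
      (∀ i, x (f i) = a ∨ x (f i) = b) ∧ (∃ i, x (f i) = a) ∧ ∃ i, x (f i) = b := by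
    simp only [hW, Finset.mem_filter, Finset.mem_univ, true_and] at hf
    refine ⟨fun i => ?_, ?_, ?_⟩
    · have : x (f i) ∈ Finset.univ.image (fun i => x (f i)) :=
        Finset.mem_image_of_mem _ (Finset.mem_univ i)
      simpa [hf] using this
    · have : a ∈ Finset.univ.image (fun i => x (f i)) := by simp [hf]
      simpa using this
    · have : b ∈ Finset.univ.image (fun i => x (f i)) := by simp [hf]
      simpa using this
  let P (S : Finset ι) : Finset (Fin n → ι) := Fintype.piFinset fun _ => S
  have hP (S : Finset ι) : (P S).card = S.card ^ n := by simp [P]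
  have d1 : Disjoint (P A) (P B) := by
    rw [Finset.disjoint_left]
    intro f hf hf'
    simp only [P, Fintype.mem_piFinset] at hf hf'
    exact Finset.disjoint_left.mp hAB (hf i₀) (hf' i₀)
  have d2 : Disjoint W (P A ∪ P B) := by
    rw [Finset.disjoint_left]
    intro f hf hf'
    obtain ⟨-, ⟨i, hi⟩, ⟨j, hj⟩⟩ := hWmem hf
    simp only [P, Finset.mem_union, Fintype.mem_piFinset, hA, hB, Finset.mem_filter,
      Finset.mem_univ, true_and] at hf'
    rcases hf' with h | h
    · exact hab ((h j).symm.trans hj)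
    · exact hab (hi.symm.trans (h i))
  have hsub : W ∪ (P A ∪ P B) ⊆ P (A ∪ B) := by
    refine Finset.union_subset (fun f hf => ?_) (Finset.union_subset ?_ ?_)
    · simpa [P, hA, hB] using (hWmem hf).1
    · exact Fintype.piFinset_subset _ _ fun _ => Finset.subset_union_left
    · exact Fintype.piFinset_subset _ _ fun _ => Finset.subset_union_right
  have hcard := Finset.card_le_card hsub
  rw [Finset.card_union_of_disjoint d2, Finset.card_union_of_disjoint d1, hP, hP, hP,
    Finset.card_union_of_disjoint hAB] at hcard
  have : (W.card : ℝ) + (A.card ^ n + B.card ^ n) ≤ (A.card + B.card) ^ n := by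
    exact_mod_cast hcard
  linarith

/-- Grouping words by their pair of values reduces the count to `twoLetterMass` of the
multiplicities, whose sum is the population size. -/
lemma card_words_card_image_eq_two_le {ι : Type*} [Fintype ι] [DecidableEq ι] (x : ι → ℝ) {n : ℕ}
    (hn : 3 ≤ n) :
    (({f : Fin n → ι | (Finset.univ.image (fun i => x (f i))).card = 2} : Finset _).card : ℝ) ≤
      (1 - (1 / 2) ^ (n - 1)) * (Fintype.card ι : ℝ) ^ n := by
  set V : Finset ℝ := Finset.univ.image x with hV
  let c (v : ℝ) : ℝ := (({i | x i = v} : Finset ι).card : ℝ)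
  have hsum : (V.val.map c).sum = Fintype.card ι := by
    have := Finset.card_eq_sum_card_image x (Finset.univ : Finset ι)
    change ∑ v ∈ V, c v = _
    rw [← Finset.card_univ, this]
    push_cast
    rfl
  have hmaps : ∀ f ∈ ({f : Fin n → ι | (Finset.univ.image (fun i => x (f i))).card = 2} :
      Finset _), Finset.univ.image (fun i => x (f i)) ∈ V.powersetCard 2 := by
    intro f hf
    simp only [Finset.mem_filter, Finset.mem_univ, true_and] at hf
    refine Finset.mem_powersetCard.mpr ⟨fun v hv => ?_, hf⟩
    obtain ⟨i, -, rfl⟩ := Finset.mem_image.mp hv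
    exact Finset.mem_image_of_mem _ (Finset.mem_univ _)
  rw [Finset.card_eq_sum_card_fiberwise hmaps]
  push_cast
  calc _ ≤ ∑ t ∈ V.powersetCard 2, ((∑ v ∈ t, c v) ^ n - ∑ v ∈ t, c v ^ n) := by
        refine Finset.sum_le_sum fun t ht => ?_
        refine le_trans ?_ (card_words_image_eq_le x (by lia) (Finset.mem_powersetCard.mp ht).2)
        gcongr
        simp
    _ = twoLetterMass n (V.val.map c) := by
        rw [twoLetterMass, Multiset.powersetCard_map, Multiset.map_map,
          ← Finset.map_val_val_powersetCard, Multiset.map_map]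
        simp only [Function.comp_def, Multiset.map_map]
        rfl
    _ ≤ _ := by
        rw [← hsum]
        refine twoLetterMass_le hn _ fun v hv => ?_
        obtain ⟨w, -, rfl⟩ := Multiset.mem_map.mp hv
        positivity

/-! ### Exchangeability and the limit -/

lemma measurableSet_card_image_range_eq_two (n : ℕ) :
    MeasurableSet {y : ℕ → ℝ | ((Finset.range n).image y).card = 2} := by
  have : {y : ℕ → ℝ | ((Finset.range n).image y).card = 2} =
      ⋃ i ∈ Finset.range n, ⋃ j ∈ Finset.range n, ({y | y i = y j}ᶜ ∩
        ⋂ k ∈ Finset.range n, ({y | y k = y i} ∪ {y | y k = y j})) := by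
    ext y
    simp only [Set.mem_ofPred_eq, Finset.card_eq_two, Set.mem_iUnion, Set.mem_inter_iff,
      Set.mem_compl_iff, Set.mem_iInter, Set.mem_union, exists_prop]
    constructor
    · rintro ⟨a, b, hab, h⟩
      obtain ⟨i, hi, rfl⟩ := Finset.mem_image.mp (show a ∈ (Finset.range n).image y by simp [h])
      obtain ⟨j, hj, rfl⟩ := Finset.mem_image.mp (show b ∈ (Finset.range n).image y by simp [h])
      refine ⟨i, hi, j, hj, hab, fun k hk => ?_⟩
      simpa [h] using Finset.mem_image_of_mem y hk
    · rintro ⟨i, hi, j, hj, hij, h⟩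
      refine ⟨y i, y j, hij, Finset.Subset.antisymm (fun v hv => ?_) fun v hv => ?_⟩
      · obtain ⟨k, hk, rfl⟩ := Finset.mem_image.mp hv
        simpa using h k hk
      · rcases Finset.mem_insert.mp hv with rfl | hv
        · exact Finset.mem_image_of_mem y hi
        · rw [Finset.mem_singleton.mp hv]
          exact Finset.mem_image_of_mem y hj
  rw [this]
  have hm (i j : ℕ) : MeasurableSet {y : ℕ → ℝ | y i = y j} :=
    measurableSet_eq_fun (measurable_pi_apply i) (measurable_pi_apply j)
  refine Finset.measurableSet_biUnion _ fun i _ => Finset.measurableSet_biUnion _ fun j _ =>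
    (hm i j).compl.inter (Finset.measurableSet_biInter _ fun k _ => (hm k i).union (hm k j))

/-- An injection of `Fin n` into `Fin N` extends to a finitely supported permutation of `ℕ`. -/
lemma exists_perm_extending {n N : ℕ} {f : Fin n → Fin N} (hf : Function.Injective f) :
    ∃ σ : Equiv.Perm ℕ, {i | σ i ≠ i}.Finite ∧ ∀ i : Fin n, σ i = f i := by
  have hnN : n ≤ N := by simpa using Fintype.card_le_of_injective f hf
  obtain ⟨τ, hτ⟩ := Equiv.Perm.exists_extending_pair (Fin.castLE hnN) f
    (Fin.castLE_injective hnN) hf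
  refine ⟨τ.extendDomain Fin.equivSubtype, ?_, fun i => ?_⟩
  · refine (Set.finite_lt_nat N).subset fun i hi => ?_
    by_contra h
    exact hi (Equiv.Perm.extendDomain_apply_not_subtype _ _ h)
  · have := Equiv.Perm.extendDomain_apply_image τ Fin.equivSubtype (Fin.castLE hnN i)
    simpa [hτ] using this

lemma image_range_eq_image_univ (n : ℕ) (y : ℕ → ℝ) :
    (Finset.range n).image y = Finset.univ.image fun i : Fin n => y i := by
  ext v
  simp only [Finset.mem_image, Finset.mem_range, Finset.mem_univ, true_and]
  exact ⟨fun ⟨i, hi, h⟩ => ⟨⟨i, hi⟩, h⟩, fun ⟨i, h⟩ => ⟨i, i.2, h⟩⟩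

lemma measurableSet_words {Ω : Type*} [MeasurableSpace Ω] {X : ℕ → Ω → ℝ}
    (hX : ∀ i, Measurable (X i)) {n N : ℕ} {f : Fin n → Fin N} (hf : Function.Injective f) :
    MeasurableSet {ω | (Finset.univ.image fun i => X (f i) ω).card = 2} := by
  obtain ⟨σ, -, hσ⟩ := exists_perm_extending hf
  have hm : Measurable fun ω (i : ℕ) => X (σ i) ω := measurable_pi_lambda _ fun i => hX _
  convert hm (measurableSet_card_image_range_eq_two n) using 1
  ext ω
  simp [image_range_eq_image_univ, hσ]

lemma Exchangeable.measureReal_words {Ω : Type*} [MeasurableSpace Ω] {μ : Measure Ω}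
    {X : ℕ → Ω → ℝ} (hexch : Exchangeable X μ) {n N : ℕ} {f : Fin n → Fin N}
    (hf : Function.Injective f) :
    μ.real {ω | (Finset.univ.image fun i => X (f i) ω).card = 2} =
      μ.real {ω | numDistinct X n ω = 2} := by
  obtain ⟨σ, hfin, hσ⟩ := exists_perm_extending hf
  have h := (hexch σ hfin).measure_mem_eq (measurableSet_card_image_range_eq_two n)
  rw [measureReal_def, measureReal_def]
  congr 1
  convert h using 2
  · ext ω
    simp [image_range_eq_image_univ, hσ]
  · rfl

/-- The bound with the finite-population correction coming from sampling without replacement. -/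
lemma Exchangeable.descFactorial_mul_le {Ω : Type*} [MeasurableSpace Ω] {μ : Measure Ω}
    [IsProbabilityMeasure μ] {X : ℕ → Ω → ℝ} (hX : ∀ i, Measurable (X i))
    (hexch : Exchangeable X μ) {n : ℕ} (hn : 3 ≤ n) (N : ℕ) :
    (N.descFactorial n : ℝ) * μ.real {ω | numDistinct X n ω = 2} ≤
      (1 - (1 / 2) ^ (n - 1)) * (N : ℝ) ^ n := by
  classical
  let E (f : Fin n → Fin N) : Set Ω := {ω | (Finset.univ.image fun i => X (f i) ω).card = 2}
  let I : Finset (Fin n → Fin N) := {f | Function.Injective f}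
  have hI : I.card = N.descFactorial n := by
    have := Fintype.card_embedding_eq (α := Fin n) (β := Fin N)
    rw [Fintype.card_fin, Fintype.card_fin] at this
    rw [← this, ← Fintype.card_subtype]
    exact Fintype.card_congr (Equiv.subtypeInjectiveEquivEmbedding _ _)
  have hE {f} (hf : f ∈ I) : MeasurableSet (E f) :=
    measurableSet_words hX (Finset.mem_filter.mp hf).2
  have hint {f} (hf : f ∈ I) : Integrable ((E f).indicator fun _ => (1 : ℝ)) μ :=
    (integrable_const 1).indicator (hE hf)
  calc (N.descFactorial n : ℝ) * μ.real {ω | numDistinct X n ω = 2}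
      = ∑ f ∈ I, μ.real (E f) := by
        rw [Finset.sum_congr rfl fun f hf =>
          hexch.measureReal_words (Finset.mem_filter.mp hf).2, Finset.sum_const, hI, nsmul_eq_mul]
    _ = ∑ f ∈ I, ∫ ω, (E f).indicator (fun _ => (1 : ℝ)) ω ∂μ :=
        Finset.sum_congr rfl fun f hf => (integral_indicator_one (hE hf)).symm
    _ = ∫ ω, ∑ f ∈ I, (E f).indicator (fun _ => (1 : ℝ)) ω ∂μ :=
        (integral_finsetSum I fun f hf => hint hf).symm
    _ ≤ ∫ _, (1 - (1 / 2) ^ (n - 1)) * (N : ℝ) ^ n ∂μ := by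
        refine integral_mono (integrable_finsetSum I fun f hf => hint hf) (integrable_const _)
          fun ω => ?_
        have h := card_words_card_image_eq_two_le (fun i : Fin N => X i ω) hn
        rw [Fintype.card_fin] at h
        refine le_trans ?_ h
        rw [Finset.card_filter]
        push_cast
        -- Non-injective words are added here.
        refine (Finset.sum_le_sum_of_subset_of_nonneg (Finset.subset_univ I)
          fun f _ _ => Set.indicator_nonneg (fun _ _ => zero_le_one) ω).trans_eq ?_
        refine Finset.sum_congr rfl fun f _ => ?_
        simp [E, Set.indicator_apply]
    _ = (1 - (1 / 2) ^ (n - 1)) * (N : ℝ) ^ n := by simp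

theorem theorem2 {Ω : Type*} [MeasurableSpace Ω] (μ : Measure Ω) [IsProbabilityMeasure μ]
    (X : ℕ → Ω → ℝ) (hX : ∀ i, Measurable (X i)) (hexch : Exchangeable X μ)
    (n : ℕ) (hn : 3 ≤ n) :
    μ.real {ω | numDistinct X n ω = 2} ≤ 1 - (2 : ℝ) ^ (-((n : ℤ) - 1)) := by
  have hpow : (2 : ℝ) ^ (-((n : ℤ) - 1)) = (1 / 2) ^ (n - 1) := by
    rw [show (n : ℤ) - 1 = ((n - 1 : ℕ) : ℤ) by lia, zpow_neg, zpow_natCast, one_div, inv_pow]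
  rw [hpow]
  have hlim : Filter.Tendsto (fun N : ℕ => (1 - (n : ℝ) / N) ^ n *
      μ.real {ω | numDistinct X n ω = 2}) Filter.atTop
      (nhds ((1 - 0) ^ n * μ.real {ω | numDistinct X n ω = 2})) :=
    ((tendsto_const_nhds.sub (tendsto_const_div_atTop_nhds_zero_nat (n : ℝ))).pow n).mul_const _
  rw [sub_zero, one_pow, one_mul] at hlim
  refine le_of_tendsto hlim ?_
  filter_upwards [Filter.eventually_ge_atTop n] with N hN
  have hN0 : (0 : ℝ) < N := by exact_mod_cast (show 0 < N by lia)
  -- Crude, but the ratio to `N ^ n` still tends to 1.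
  have hdesc : ((N : ℝ) - n) ^ n ≤ N.descFactorial n := by
    rw [← Nat.cast_sub hN]
    exact_mod_cast (Nat.pow_le_pow_left (by lia) n).trans (Nat.pow_sub_le_descFactorial N n)
  have hmain := hexch.descFactorial_mul_le hX hn N
  have h := (mul_le_mul_of_nonneg_right hdesc measureReal_nonneg).trans hmain
  rw [one_sub_div hN0.ne', div_pow, div_mul_eq_mul_div, div_le_iff₀ (by positivity)]
  exact h
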